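/- Let $L$ be a locale (that is, a frame), with pseudocomplements $a^*$. Write $b\prec a$ if $b^*\vee a=1$, and write $b\prec\!\!\prec a$ ($b$ is completely below $a$) if there is a family $\{a_q\mid q\in[0,1]\cap\mathbb Q\}\subseteq L$ with $a_0=b$, $a_1=a$ and $a_p\prec a_q$ whenever $p<q$. A localic map $f\colon L\to M$ is the right adjoint of a frame homomorphism $h\colon M\to L$. A sublocale of $L$ is a subset $S\subseteq L$ closed under arbitrary meets and such that $x\to s\in S$ for all $x\in L$, $s\in S$. The closed and open sublocales are $\mathfrak c(a)=\{x\mid x\ge a\}$ and $\mathfrak o(a)=\{a\to b\mid b\in L\}$ for $a\in L$; a sublocale is clopen if it is both closed and open; the closure $\overline S$ is the least closed sublocale containing $S$. For a localic map $f$ and a sublocale $T$ of $M$, $f_{-1}[T]$ denotes the largest sublocale of $L$ contained in the set-theoretic preimage $f^{-1}[T]$. The Stone–Čech compactification $\beta L$ is the frame, ordered by inclusion, of the ideals $I$ of $L$ such that for every $a\in I$ there is $b\in I$ with $a\prec\!\!\prec b$; the localic map $\beta_L\colon L\to\beta L$ is $a\mapsto\{x\in L\mid x\prec\!\!\prec a\}$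 (its left adjoint takes joins of ideals); and for a localic map $f\colon L\to M$ with left adjoint $h$, the localic map $f^\beta\colon\beta L\to\beta M$ is the right adjoint of $I\mapsto{\downarrow}h[I]$. The map $f$ is an $\mathfrak S_{\mathfrak o}\beta$-map if $$\overline{\beta_L\big[f_{-1}[T]\big]}=f^\beta_{-1}\big[\,\overline{\beta_M[T]}\,\big]\quad\text{for every open sublocale } T \text{ of } M,$$ where the closures are taken in $\beta L$ and in $\beta M$ respectively. A continuous real-valued function on a locale $L$ is a localic map from $L$ to the locale of reals, i.e. a frame homomorphism $\varphi\colon\mathcal O(\mathbb R)\to L$; it is bounded if $\varphi((p,q))=1$ for some reals $p,q$. A sublocale $S$ of $L$ is $C^*$-embedded if every bounded continuous real-valued function on $S$ extends to a continuous real-valued function on $L$. **Proposition.** Let $S$ be a sublocale of a locale $L$ and let $j\colon S\hookrightarrow L$ be its localic embedding. Then $j$ is an $\mathfrak S_{\mathfrak o}\beta$-map if and only if $S$ is $C^*$-embedded in $L$ and $\overline S$ is clopen. Moreover, $j$ is an $\mathfrak S_{\mathfrak o}\beta$-map if and only if it preserves $\prec\!\!\prec$, that is, $a\prec\!\!\prec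 b$ in $S$ implies $a\prec\!\!\prec b$ in $L$ for all $a,b\in S$. -/

import Mathlib

universe u

namespace Loc

open TopologicalSpace

/-! ### The rather below and the completely below relations -/

section Below

variable {L : Type u} [Order.Frame L]

/-- The rather below relation `b ≺ a`. -/
def RatherBelow (b a : L) : Prop := bᶜ ⊔ a = ⊤

/-- The completely below relation: there is a family indexed by the rationals of `[0, 1]`, from `b`
to `a`, that is strictly increasing for the rather below relation. (The values of `c` outside
`[0, 1]` play no role.) -/
def CompletelyBelow (b a : L) : Prop :=
  ∃ c : ℚ → L, c 0 = b ∧ c 1 = a ∧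
    ∀ p q : ℚ, 0 ≤ p → p < q → q ≤ 1 → RatherBelow (c p) (c q)

theorem RatherBelow.le {b a : L} (h : RatherBelow b a) : b ≤ a := by
  have h1 : b ⊓ (bᶜ ⊔ a) = b := by rw [h, inf_top_eq]
  rw [inf_sup_left, inf_compl_self, bot_sup_eq] at h1
  exact inf_eq_left.mp h1

theorem RatherBelow.mono {b b' a a' : L} (hb : b' ≤ b) (h : RatherBelow b a) (ha : a ≤ a') :
    RatherBelow b' a' :=
  top_le_iff.mp (h.symm.le.trans (sup_le_sup (compl_le_compl hb) ha))

theorem RatherBelow.inf {b a d c : L} (h : RatherBelow b a) (h' : RatherBelow d c) :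
    RatherBelow (b ⊓ d) (a ⊓ c) := by
  have h1 : RatherBelow (b ⊓ d) a := h.mono inf_le_left le_rfl
  have h2 : RatherBelow (b ⊓ d) c := h'.mono inf_le_right le_rfl
  unfold RatherBelow at *
  rw [sup_inf_left, h1, h2, inf_top_eq]

theorem RatherBelow.sup {b a d c : L} (h : RatherBelow b a) (h' : RatherBelow d c) :
    RatherBelow (b ⊔ d) (a ⊔ c) := by
  have h1 : bᶜ ⊔ (a ⊔ c) = ⊤ := h.mono le_rfl le_sup_left
  have h2 : dᶜ ⊔ (a ⊔ c) = ⊤ := h'.mono le_rfl le_sup_right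
  unfold RatherBelow
  rw [compl_sup, sup_inf_right, h1, h2, inf_top_eq]

theorem RatherBelow.map {M : Type u} [Order.Frame M] (h : FrameHom M L) {b a : M}
    (hba : RatherBelow b a) : RatherBelow (h b) (h a) := by
  have h1 : h bᶜ ≤ (h b)ᶜ := by
    rw [le_compl_iff_disjoint_right, disjoint_iff, ← map_inf, compl_inf_self, map_bot]
  have h2 : h bᶜ ⊔ h a = ⊤ := by rw [← map_sup, hba, map_top]
  exact top_le_iff.mp (h2.symm.le.trans (sup_le_sup_right h1 _))

theorem CompletelyBelow.le {b a : L} (h : CompletelyBelow b a) : b ≤ a := by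
  obtain ⟨c, rfl, rfl, hc⟩ := h
  exact (hc 0 1 le_rfl one_pos le_rfl).le

theorem CompletelyBelow.mono {b b' a a' : L} (hb : b' ≤ b) (h : CompletelyBelow b a)
    (ha : a ≤ a') : CompletelyBelow b' a' := by
  obtain ⟨c, rfl, rfl, hc⟩ := h
  refine ⟨fun q ↦ if q = 0 then b' else if q = 1 then a' else c q, by simp, by simp, ?_⟩
  intro p q hp hpq hq
  refine (hc p q hp hpq hq).mono ?_ ?_
  · have hp1 : p ≠ 1 := by linarith [hpq.trans_le hq] |> fun h : p < 1 ↦ h.ne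
    by_cases h0 : p = 0
    · simpa [h0] using hb
    · simp [h0, hp1]
  · have hq0 : q ≠ 0 := (hp.trans_lt hpq).ne'
    by_cases h1 : q = 1
    · simpa [h1] using ha
    · simp [h1, hq0]

theorem CompletelyBelow.inf {b a d c : L} (h : CompletelyBelow b a) (h' : CompletelyBelow d c) :
    CompletelyBelow (b ⊓ d) (a ⊓ c) := by
  obtain ⟨x, rfl, rfl, hx⟩ := h
  obtain ⟨y, rfl, rfl, hy⟩ := h'
  exact ⟨fun q ↦ x q ⊓ y q, rfl, rfl, fun p q hp hpq hq ↦ (hx p q hp hpq hq).inf (hy p q hp hpq hq)⟩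

theorem CompletelyBelow.sup {b a d c : L} (h : CompletelyBelow b a) (h' : CompletelyBelow d c) :
    CompletelyBelow (b ⊔ d) (a ⊔ c) := by
  obtain ⟨x, rfl, rfl, hx⟩ := h
  obtain ⟨y, rfl, rfl, hy⟩ := h'
  exact ⟨fun q ↦ x q ⊔ y q, rfl, rfl, fun p q hp hpq hq ↦ (hx p q hp hpq hq).sup (hy p q hp hpq hq)⟩

theorem CompletelyBelow.map {M : Type u} [Order.Frame M] (h : FrameHom M L) {b a : M}
    (hba : CompletelyBelow b a) : CompletelyBelow (h b) (h a) := by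
  obtain ⟨x, rfl, rfl, hx⟩ := hba
  exact ⟨fun q ↦ h (x q), rfl, rfl, fun p q hp hpq hq ↦ (hx p q hp hpq hq).map h⟩

theorem CompletelyBelow.bot (a : L) : CompletelyBelow ⊥ a :=
  CompletelyBelow.mono le_rfl ⟨fun _ ↦ ⊥, rfl, rfl, fun _ _ _ _ _ ↦ by simp [RatherBelow]⟩ bot_le

theorem CompletelyBelow.top : CompletelyBelow (⊤ : L) ⊤ :=
  ⟨fun _ ↦ ⊤, rfl, rfl, fun _ _ _ _ _ ↦ by simp [RatherBelow]⟩

theorem CompletelyBelow.interpolate {b a : L} (h : CompletelyBelow b a) :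
    ∃ d, CompletelyBelow b d ∧ CompletelyBelow d a := by
  obtain ⟨c, rfl, rfl, hc⟩ := h
  refine ⟨c (1 / 2), ⟨fun q ↦ c (q / 2), by simp, by simp, fun p q hp hpq hq ↦ ?_⟩,
    ⟨fun q ↦ c ((1 + q) / 2), by simp, by norm_num, fun p q hp hpq hq ↦ ?_⟩⟩
  · exact hc _ _ (by linarith) (by linarith) (by linarith)
  · exact hc _ _ (by linarith) (by linarith) (by linarith)

end Below

/-! ### Localic maps, and images and preimages of sublocales -/

/-- A localic map `f : L → M`: the right adjoint of a frame homomorphism `h : M → L`. Each of `f`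
and `h` determines the other. -/
structure LocalicMap (L M : Type u) [Order.Frame L] [Order.Frame M] where
  /-- the underlying map `f` -/
  toFun : L → M
  /-- the left adjoint frame homomorphism `h` -/
  leftAdjoint : FrameHom M L
  /-- `h` is left adjoint to `f` -/
  gc : GaloisConnection leftAdjoint toFun

namespace LocalicMap

variable {L M : Type u} [Order.Frame L] [Order.Frame M]

/-- The localic map that is right adjoint to a given frame homomorphism. -/
def ofFrameHom (h : FrameHom M L) : LocalicMap L M where
  toFun b := sSup {a | h a ≤ b}
  leftAdjoint := h
  gc a b := by
    refine ⟨fun hab ↦ le_sSup hab, fun hab ↦ ?_⟩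
    calc h a ≤ h (sSup {a | h a ≤ b}) := OrderHomClass.mono h hab
      _ = sSup (h '' {a | h a ≤ b}) := map_sSup h _
      _ ≤ b := sSup_le (by rintro _ ⟨x, hx, rfl⟩; exact hx)

theorem map_himp (f : LocalicMap L M) (a : M) (b : L) :
    f.toFun (f.leftAdjoint a ⇨ b) = a ⇨ f.toFun b := by
  refine eq_of_forall_le_iff fun c ↦ ?_
  rw [← f.gc, le_himp_iff, le_himp_iff, ← f.gc, map_inf]

/-- The set-theoretic image `f[S]` of a sublocale, which is a sublocale. -/
def image (f : LocalicMap L M) (S : Sublocale L) : Sublocale M where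
  carrier := f.toFun '' (S : Set L)
  sInf_mem' s hs := by
    refine ⟨sInf {x | x ∈ S ∧ f.toFun x ∈ s}, S.sInf_mem fun x hx ↦ hx.1, ?_⟩
    rw [f.gc.u_sInf]
    refine le_antisymm (le_sInf fun y hy ↦ ?_)
      (le_iInf₂ fun x hx ↦ sInf_le hx.2)
    obtain ⟨x, hx, rfl⟩ := hs hy
    exact iInf₂_le x ⟨hx, hy⟩
  himp_mem' a b := by
    rintro ⟨x, hx, rfl⟩
    exact ⟨f.leftAdjoint a ⇨ x, S.himp_mem hx, f.map_himp a x⟩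

/-- The localic preimage `f₋₁[T]`: the largest sublocale contained in the set-theoretic preimage,
see `isGreatest_preimage`. -/
def preimage (f : LocalicMap L M) (T : Sublocale M) : Sublocale L where
  carrier := {x | ∀ y : L, f.toFun (y ⇨ x) ∈ T}
  sInf_mem' s hs y := by
    have : f.toFun (y ⇨ sInf s) = ⨅ x : s, f.toFun (y ⇨ x) := by
      rw [sInf_eq_iInf', himp_iInf_eq, f.gc.u_iInf]
    rw [this]
    exact T.iInf_mem fun x ↦ hs x.2 y
  himp_mem' a b hb y := by
    rw [himp_himp]
    exact hb _

theorem isGreatest_preimage (f : LocalicMap L M) (T : Sublocale M) :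
    IsGreatest {S : Sublocale L | (S : Set L) ⊆ f.toFun ⁻¹' (T : Set M)} (f.preimage T) := by
  refine ⟨fun x hx ↦ ?_, fun S hS x hx y ↦ hS (S.himp_mem hx)⟩
  have := hx ⊤
  rwa [top_himp] at this

/-- A localic map that preserves the completely below relation. -/
def PreservesCompletelyBelow (f : LocalicMap L M) : Prop :=
  ∀ a b : L, CompletelyBelow a b → CompletelyBelow (f.toFun a) (f.toFun b)

end LocalicMap

/-! ### Closed and open sublocales, closure -/

section Sublocales

variable {L : Type u} [Order.Frame L]

/-- The closed sublocale `𝔠(a) = {x | a ≤ x}`. -/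
def closedSublocale (a : L) : Sublocale L where
  carrier := {x | a ≤ x}
  sInf_mem' _ hs := le_sInf hs
  himp_mem' _ _ hb := le_trans hb le_himp

/-- The open sublocale `𝔬(a) = {a ⇨ b | b}`. -/
def openSublocale (a : L) : Sublocale L where
  carrier := {x | ∃ b, x = a ⇨ b}
  sInf_mem' s hs := by
    refine ⟨sInf s, ?_⟩
    rw [sInf_eq_iInf', himp_iInf_eq]
    refine iInf_congr fun x ↦ ?_
    obtain ⟨b, hb⟩ := hs x.2
    rw [hb, himp_himp, inf_idem]
  himp_mem' y x := by
    rintro ⟨b, rfl⟩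
    exact ⟨y ⇨ b, himp_left_comm _ _ _⟩

/-- Closed sublocales. -/
def IsClosedSublocale (S : Sublocale L) : Prop := ∃ a : L, S = closedSublocale a

/-- Open sublocales. -/
def IsOpenSublocale (S : Sublocale L) : Prop := ∃ a : L, S = openSublocale a

/-- Clopen sublocales. -/
def IsClopenSublocale (S : Sublocale L) : Prop := IsClosedSublocale S ∧ IsOpenSublocale S

/-- The closure of a sublocale: the least closed sublocale that contains it, see
`isLeast_closure`. -/
def closure (S : Sublocale L) : Sublocale L := closedSublocale (sInf (S : Set L))

theorem isLeast_closure (S : Sublocale L) :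
    IsLeast {T : Sublocale L | IsClosedSublocale T ∧ S ≤ T} (closure S) := by
  refine ⟨⟨⟨_, rfl⟩, fun x hx ↦ sInf_le hx⟩, ?_⟩
  rintro _ ⟨⟨a, rfl⟩, hS⟩ x hx
  exact le_trans (le_sInf fun y hy ↦ hS hy) hx

/-- The localic embedding `j : S ↪ L` of a sublocale. -/
def embedding (S : Sublocale L) : LocalicMap S L where
  toFun := Subtype.val
  leftAdjoint := S.restrict
  gc := S.giRestrict.gc

end Sublocales

/-! ### The Stone–Čech compactification -/

/-- The Stone–Čech compactification `βL`: the ideals `I` of `L` such that every element of `I` is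
completely below some element of `I`, ordered by inclusion. -/
def StoneCech (L : Type u) [Order.Frame L] : Type u :=
  {I : Order.Ideal L // ∀ a ∈ I, ∃ b ∈ I, CompletelyBelow a b}

namespace StoneCech

variable {L : Type u} [Order.Frame L]

instance : PartialOrder (StoneCech L) := inferInstanceAs (PartialOrder (Subtype _))

instance : SetLike (StoneCech L) L where
  coe I := (I.1 : Set L)
  coe_injective _ _ h := Subtype.ext (SetLike.coe_injective h)

theorem le_iff {I J : StoneCech L} : I ≤ J ↔ ∀ x ∈ I, x ∈ J := Iff.rfl

theorem mem_of_le (I : StoneCech L) {x y : L} (h : x ≤ y) (hy : y ∈ I) : x ∈ I := I.1.lower h hy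

theorem bot_mem (I : StoneCech L) : ⊥ ∈ I := Order.Ideal.bot_mem I.1

theorem sup_mem (I : StoneCech L) {x y : L} (hx : x ∈ I) (hy : y ∈ I) : x ⊔ y ∈ I :=
  Order.Ideal.sup_mem hx hy

theorem exists_mem (I : StoneCech L) {x : L} (hx : x ∈ I) : ∃ y ∈ I, CompletelyBelow x y := I.2 x hx

/-- A constructor from the usual closure properties. -/
def ofSet (I : Set L) (lower : ∀ x y, x ≤ y → y ∈ I → x ∈ I) (bot : ⊥ ∈ I)
    (sup : ∀ x ∈ I, ∀ y ∈ I, x ⊔ y ∈ I) (reg : ∀ x ∈ I, ∃ y ∈ I, CompletelyBelow x y) :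
    StoneCech L :=
  ⟨{ carrier := I
     lower' := fun y x h hy ↦ lower x y h hy
     nonempty' := ⟨⊥, bot⟩
     directed' := fun x hx y hy ↦ ⟨x ⊔ y, sup x hx y hy, le_sup_left, le_sup_right⟩ }, reg⟩

theorem mem_ofSet {I : Set L} {h1 h2 h3 h4} {x : L} : x ∈ ofSet I h1 h2 h3 h4 ↔ x ∈ I := Iff.rfl

/-- The intersection of two regular ideals. -/
def inter (I J : StoneCech L) : StoneCech L :=
  ofSet {x | x ∈ I ∧ x ∈ J}
    (fun _ _ h hy ↦ ⟨I.mem_of_le h hy.1, J.mem_of_le h hy.2⟩)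
    ⟨I.bot_mem, J.bot_mem⟩
    (fun _ hx _ hy ↦ ⟨I.sup_mem hx.1 hy.1, J.sup_mem hx.2 hy.2⟩)
    (fun x hx ↦ by
      obtain ⟨y, hy, hxy⟩ := I.exists_mem hx.1
      obtain ⟨z, hz, hxz⟩ := J.exists_mem hx.2
      exact ⟨y ⊓ z, ⟨I.mem_of_le inf_le_left hy, J.mem_of_le inf_le_right hz⟩,
        (hxy.inf hxz).mono (le_inf le_rfl le_rfl) le_rfl⟩)

/-- The regular ideal generated by the union of a set of regular ideals: the elements below the join
of a finite list of elements of the union. -/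
def join (𝒥 : Set (StoneCech L)) : StoneCech L :=
  ofSet {x | ∃ F : List L, (∀ a ∈ F, ∃ I ∈ 𝒥, a ∈ I) ∧ x ≤ F.foldr (· ⊔ ·) ⊥}
    (fun _ _ h ⟨F, hF, hy⟩ ↦ ⟨F, hF, h.trans hy⟩)
    ⟨[], by simp, by simp⟩
    (fun x ⟨F, hF, hx⟩ y ⟨G, hG, hy⟩ ↦ by
      refine ⟨F ++ G, fun a ha ↦ (List.mem_append.mp ha).elim (hF a) (hG a), ?_⟩
      have key : ∀ F : List L, (F ++ G).foldr (· ⊔ ·) ⊥ =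
          F.foldr (· ⊔ ·) ⊥ ⊔ G.foldr (· ⊔ ·) ⊥ := by
        intro F
        induction F with
        | nil => simp
        | cons a F ih =>
          rw [List.cons_append, List.foldr_cons, List.foldr_cons, ih, sup_assoc]
      rw [key]
      exact sup_le_sup hx hy)
    (fun x ⟨F, hF, hx⟩ ↦ by
      have key : ∀ F : List L, (∀ a ∈ F, ∃ I ∈ 𝒥, a ∈ I) → ∃ G : List L,
          (∀ a ∈ G, ∃ I ∈ 𝒥, a ∈ I) ∧
          CompletelyBelow (F.foldr (· ⊔ ·) ⊥) (G.foldr (· ⊔ ·) ⊥) := by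
        intro F
        induction F with
        | nil => exact fun _ ↦ ⟨[], by simp, CompletelyBelow.bot _⟩
        | cons a F ih =>
          intro h
          obtain ⟨G, hG, hFG⟩ := ih fun b hb ↦ h b (List.mem_cons_of_mem _ hb)
          obtain ⟨I, hI, haI⟩ := h a List.mem_cons_self
          obtain ⟨b, hb, hab⟩ := I.exists_mem haI
          refine ⟨b :: G, ?_, hab.sup hFG⟩
          intro c hc
          rcases List.mem_cons.mp hc with rfl | hc
          · exact ⟨I, hI, hb⟩
          · exact hG c hc
      obtain ⟨G, hG, hFG⟩ := key F hF
      exact ⟨_, ⟨G, hG, le_rfl⟩, hFG.mono hx le_rfl⟩)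

theorem mem_join {𝒥 : Set (StoneCech L)} {x : L} : x ∈ join 𝒥 ↔
    ∃ F : List L, (∀ a ∈ F, ∃ I ∈ 𝒥, a ∈ I) ∧ x ≤ F.foldr (· ⊔ ·) ⊥ := Iff.rfl

theorem foldr_mem (I : StoneCech L) (F : List L) (h : ∀ a ∈ F, a ∈ I) :
    F.foldr (· ⊔ ·) ⊥ ∈ I := by
  induction F with
  | nil => exact I.bot_mem
  | cons a F ih =>
    exact I.sup_mem (h a List.mem_cons_self) (ih fun b hb ↦ h b (List.mem_cons_of_mem _ hb))

theorem isLUB_join (𝒥 : Set (StoneCech L)) : IsLUB 𝒥 (join 𝒥) := by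
  refine ⟨fun I hI x hx ↦ ⟨[x], ?_, by simp⟩, fun J hJ x ↦ ?_⟩
  · intro a ha
    rw [List.mem_singleton.mp ha]
    exact ⟨I, hI, hx⟩
  · rintro ⟨F, hF, hx⟩
    refine J.mem_of_le hx (J.foldr_mem F fun a ha ↦ ?_)
    obtain ⟨I, hI, haI⟩ := hF a ha
    exact hJ hI haI

instance : CompleteLattice (StoneCech L) :=
  letI : SupSet (StoneCech L) := ⟨join⟩
  { completeLatticeOfSup (StoneCech L) isLUB_join with
    inf := inter
    inf_le_left := fun _ _ _ hx ↦ hx.1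
    inf_le_right := fun _ _ _ hx ↦ hx.2
    le_inf := fun _ _ _ h h' _ hx ↦ ⟨h hx, h' hx⟩ }

theorem mem_inf {I J : StoneCech L} {x : L} : x ∈ I ⊓ J ↔ x ∈ I ∧ x ∈ J := Iff.rfl

theorem sSup_eq (𝒥 : Set (StoneCech L)) : sSup 𝒥 = join 𝒥 :=
  (isLUB_sSup 𝒥).unique (isLUB_join 𝒥)

instance : Order.Frame (StoneCech L) :=
  Order.Frame.ofMinimalAxioms
    { inf_sSup_le_iSup_inf := fun I 𝒥 x hx ↦ by
        obtain ⟨hxI, hx⟩ := mem_inf.mp hx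
        rw [sSup_eq] at hx
        obtain ⟨F, hF, hxF⟩ := hx
        have key : ∀ F : List L, x ⊓ F.foldr (· ⊔ ·) ⊥ = (F.map (x ⊓ ·)).foldr (· ⊔ ·) ⊥ := by
          intro F
          induction F with
          | nil => simp
          | cons a F ih => rw [List.foldr_cons, inf_sup_left, ih]; rfl
        rw [← inf_eq_left.mpr hxF, key]
        refine foldr_mem _ _ fun b hb ↦ ?_
        obtain ⟨a, ha, rfl⟩ := List.mem_map.mp hb
        obtain ⟨J, hJ, haJ⟩ := hF a ha
        exact (le_iSup₂ (f := fun J (_ : J ∈ 𝒥) ↦ I ⊓ J) J hJ)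
          (mem_inf.mpr ⟨I.mem_of_le inf_le_left hxI, J.mem_of_le inf_le_right haJ⟩) }

/-- The regular ideal of the elements completely below `a`. -/
def below (a : L) : StoneCech L :=
  ofSet {x | CompletelyBelow x a}
    (fun _ _ h hy ↦ hy.mono h le_rfl)
    (CompletelyBelow.bot a)
    (fun _ hx _ hy ↦ (hx.sup hy).mono le_rfl (sup_le le_rfl le_rfl))
    (fun _ hx ↦ by
      obtain ⟨d, h1, h2⟩ := CompletelyBelow.interpolate hx
      exact ⟨d, h2, h1⟩)

theorem sSup_le_iff_le_below (I : StoneCech L) (a : L) :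
    sSup (I : Set L) ≤ a ↔ I ≤ below a := by
  refine ⟨fun h x hx ↦ ?_, fun h ↦ sSup_le fun x hx ↦ CompletelyBelow.le (h hx)⟩
  obtain ⟨y, hy, hxy⟩ := I.exists_mem hx
  exact hxy.mono le_rfl ((le_sSup hy).trans h)

theorem mem_top (x : L) : x ∈ (⊤ : StoneCech L) :=
  (le_top : ofSet (Set.univ : Set L) (fun _ _ _ _ ↦ trivial) trivial (fun _ _ _ _ ↦ trivial)
    (fun _ _ ↦ ⟨⊤, trivial, CompletelyBelow.top.mono le_top le_rfl⟩) ≤ ⊤) (Set.mem_univ x)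

/-- The frame homomorphism `βL → L` that takes joins of ideals. -/
def joinHom (L : Type u) [Order.Frame L] : FrameHom (StoneCech L) L where
  toFun I := sSup (I : Set L)
  map_inf' I J := by
    refine le_antisymm
      (le_inf (sSup_le_sSup fun x hx ↦ hx.1) (sSup_le_sSup fun x hx ↦ hx.2)) ?_
    rw [sSup_inf_sSup]
    refine iSup₂_le fun p hp ↦ le_sSup (mem_inf.mpr ⟨?_, ?_⟩)
    · exact I.mem_of_le inf_le_left hp.1
    · exact J.mem_of_le inf_le_right hp.2
  map_top' := top_le_iff.mp (le_sSup (mem_top ⊤))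
  map_sSup' 𝒥 := by
    have gc : GaloisConnection (fun I : StoneCech L ↦ sSup (I : Set L)) below :=
      sSup_le_iff_le_below
    have := gc.l_sSup (s := 𝒥)
    rw [sSup_image]
    exact this

/-- The localic map `β_L : L → βL` that sends `a` to the ideal of the elements completely
below `a`. -/
def unit (L : Type u) [Order.Frame L] : LocalicMap L (StoneCech L) where
  toFun := below
  leftAdjoint := joinHom L
  gc := sSup_le_iff_le_below

variable {M : Type u} [Order.Frame M]

/-- The regular ideal `↓h[I]` for a regular ideal `I`. -/
def pushforward (h : FrameHom M L) (I : StoneCech M) : StoneCech L :=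
  ofSet {x | ∃ y ∈ I, x ≤ h y}
    (fun _ _ hxy ⟨z, hz, hy⟩ ↦ ⟨z, hz, hxy.trans hy⟩)
    ⟨⊥, I.bot_mem, bot_le⟩
    (fun _ ⟨z, hz, hx⟩ _ ⟨w, hw, hy⟩ ↦
      ⟨z ⊔ w, I.sup_mem hz hw, by rw [map_sup]; exact sup_le_sup hx hy⟩)
    (fun _ ⟨z, hz, hx⟩ ↦ by
      obtain ⟨w, hw, hzw⟩ := I.exists_mem hz
      exact ⟨h w, ⟨w, hw, le_rfl⟩, (hzw.map h).mono hx le_rfl⟩)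

/-- The frame homomorphism `h^β : βM → βL`, `I ↦ ↓h[I]`. -/
def mapHom (h : FrameHom M L) : FrameHom (StoneCech M) (StoneCech L) where
  toFun := pushforward h
  map_inf' I J := by
    refine le_antisymm (fun x ⟨y, hy, hx⟩ ↦ ⟨⟨y, hy.1, hx⟩, ⟨y, hy.2, hx⟩⟩) ?_
    rintro x ⟨⟨y, hy, hxy⟩, ⟨z, hz, hxz⟩⟩
    refine ⟨y ⊓ z, ⟨I.mem_of_le inf_le_left hy, J.mem_of_le inf_le_right hz⟩, ?_⟩
    rw [map_inf]
    exact le_inf hxy hxz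
  map_top' := top_le_iff.mp fun x _ ↦ ⟨⊤, mem_top ⊤, by rw [map_top]; exact le_top⟩
  map_sSup' 𝒥 := by
    refine le_antisymm ?_ ?_
    · rintro x ⟨y, hy, hxy⟩
      rw [sSup_eq] at hy
      obtain ⟨F, hF, hyF⟩ := hy
      have key : ∀ F : List M, h (F.foldr (· ⊔ ·) ⊥) = (F.map h).foldr (· ⊔ ·) ⊥ := by
        intro F
        induction F with
        | nil => simp
        | cons a F ih => rw [List.foldr_cons, map_sup, ih]; rfl
      refine mem_of_le _ (hxy.trans ((OrderHomClass.mono h hyF).trans (key F).le))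
        (foldr_mem _ _ fun b hb ↦ ?_)
      obtain ⟨a, ha, rfl⟩ := List.mem_map.mp hb
      obtain ⟨J, hJ, haJ⟩ := hF a ha
      exact (le_sSup (Set.mem_image_of_mem _ hJ) : pushforward h J ≤ _) ⟨a, haJ, le_rfl⟩
    · refine sSup_le ?_
      rintro _ ⟨J, hJ, rfl⟩ x ⟨y, hy, hxy⟩
      exact ⟨y, (le_sSup hJ : J ≤ _) hy, hxy⟩

/-- The Stone extension `f^β : βL → βM` of a localic map `f : L → M`: the localic map whose left
adjoint is `h^β`, where `h` is the left adjoint of `f`. -/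
def map (f : LocalicMap L M) : LocalicMap (StoneCech L) (StoneCech M) :=
  LocalicMap.ofFrameHom (mapHom f.leftAdjoint)

end StoneCech

/-! ### `𝔖β`-maps -/

/-- A selection function on sublocales: it assigns to each locale a set of its sublocales. -/
def SelectionFunction : Type (u + 1) := ∀ (L : Type u) [Order.Frame L], Set (Sublocale L)

/-- The selection `𝔖_𝔬` of the open sublocales. -/
def openSelection : SelectionFunction.{u} := fun L _ ↦ {S : Sublocale L | IsOpenSublocale S}

/-- `f : L → M` is an `𝔖β`-map: for every `S ∈ 𝔖M`, the closure in `βL` of `β_L[f₋₁[S]]` is the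
localic preimage under `f^β` of the closure in `βM` of `β_M[S]`. -/
def IsBetaMap (𝔖 : SelectionFunction.{u}) {L M : Type u} [Order.Frame L] [Order.Frame M]
    (f : LocalicMap L M) : Prop :=
  ∀ S ∈ 𝔖 M, closure ((StoneCech.unit L).image (f.preimage S)) =
    (StoneCech.map f).preimage (closure ((StoneCech.unit M).image S))

/-! ### Continuous real-valued functions and `C*`-embedded sublocales -/

/-- A continuous real-valued function on the locale `L`, that is, a localic map from `L` to the
locale of reals, given by the corresponding frame homomorphism `𝒪(ℝ) → L`. -/
abbrev RealFunction (L : Type u) [Order.Frame L] := FrameHom (Opens ℝ) L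

/-- A continuous real-valued function is bounded if it takes its values in some interval. -/
def RealFunction.IsBounded {L : Type u} [Order.Frame L] (f : RealFunction L) : Prop :=
  ∃ a b : ℝ, f ⟨Set.Ioo a b, isOpen_Ioo⟩ = ⊤

/-- `S` is `C*`-embedded in `L`: every bounded continuous real-valued function on `S` extends
to `L`. (The restriction of `g` to `S` is, as a frame homomorphism, `g` followed by the left adjoint
`L → S` of the embedding.) -/
def IsCStarEmbedded {L : Type u} [Order.Frame L] (S : Sublocale L) : Prop :=
  ∀ f : RealFunction S, f.IsBounded → ∃ g : RealFunction L, (embedding S).leftAdjoint.comp g = f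

end Loc

namespace Loc

open TopologicalSpace

/-! ### Frame homomorphisms out of the frame of opens of the reals -/

section RealFunctions

variable {M : Type u} [Order.Frame M]

/-! Write `ν` for the reflection `S.restrict : L → S` and `z` for the bottom of `S` seen in `L`. The
closure of `S` is `𝔠(z)`, which is clopen exactly when `z ≺ z`, that is, when `z` is complemented.
Both closures in the definition of an `𝔖_𝔬β`-map are closed sublocales; comparing their least
elements turns the definition into a condition on elements (`isBetaMap_embedding_iff`): if `x ≺≺ (ν
b)ᶜ` in `S`, then `x ≤ ν y` for some `y ≺≺ bᶜ` in `L`.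

Each of the conditions "`𝔖_𝔬β`-map" and "preserves `≺≺`" forces `z ≺ z`: the latter because `⊥ ≺≺ ⊥`
in `S`. Once `z` is complemented, `ν` as a map `L → L` preserves `≺≺`
(`CompletelyBelow.coe_restrict`), which carries relations found in `L` back to elements of `S`;
conversely, meeting with `zᶜ` changes nothing in `S`, since `ν zᶜ = ⊤`. This gives the second
equivalence.

For `C*`-embedding, `≺≺` is witnessed by bounded real functions
(`CompletelyBelow.exists_realFunction`). Extending the function that witnesses `a ≺≺ b` in `S` and
reflecting its rays gives `a ≺≺ b` in `L`. Conversely, if `≺≺` is preserved, the rays of a bounded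
function on `S`, cut down by `zᶜ`, form a scale in `L`, and this scale defines an extension. -/

/-- The open ray `(-∞, r)`. -/
def openIio (r : ℝ) : Opens ℝ := ⟨Set.Iio r, isOpen_Iio⟩

/-- The open ray `(r, ∞)`. -/
def openIoi (r : ℝ) : Opens ℝ := ⟨Set.Ioi r, isOpen_Ioi⟩

theorem openIio_inf_openIoi {r s : ℝ} (h : r ≤ s) : openIio r ⊓ openIoi s = ⊥ := by
  ext x
  simp only [openIio, openIoi, Opens.coe_inf, Opens.coe_mk, Opens.coe_bot, Set.mem_inter_iff,
    Set.mem_Iio, Set.mem_Ioi, Set.mem_empty_iff_false, iff_false]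
  exact fun hx ↦ absurd (hx.1.trans_le h) hx.2.not_gt

theorem openIoi_sup_openIio {r s : ℝ} (h : r < s) : openIoi r ⊔ openIio s = ⊤ := by
  ext x
  simp only [openIio, openIoi, Opens.coe_sup, Opens.coe_mk, Opens.coe_top, Set.mem_union,
    Set.mem_Iio, Set.mem_Ioi, Set.mem_univ, iff_true]
  exact (lt_or_ge r x).imp id fun hx ↦ hx.trans_lt h

theorem openIio_eq_iSup (s : ℝ) : openIio s = ⨆ r : {r : ℝ // r < s}, openIio r := by
  ext x
  simp only [openIio, Opens.coe_mk, Opens.coe_iSup, Set.mem_Iio, Set.mem_iUnion, Subtype.exists,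
    exists_prop]
  exact ⟨fun hx ↦ (exists_between hx).imp fun r hr ↦ ⟨hr.2, hr.1⟩, fun ⟨r, hr, hx⟩ ↦ hx.trans hr⟩

theorem openIoi_eq_iSup (s : ℝ) : openIoi s = ⨆ r : {r : ℝ // s < r}, openIoi r := by
  ext x
  simp only [openIoi, Opens.coe_mk, Opens.coe_iSup, Set.mem_Ioi, Set.mem_iUnion, Subtype.exists,
    exists_prop]
  exact ⟨fun hx ↦ (exists_between hx).imp fun r hr ↦ ⟨hr.1, hr.2⟩, fun ⟨r, hr, hx⟩ ↦ hr.trans hx⟩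

theorem opens_eq_iSup_openIio_inf_openIoi (U : Opens ℝ) :
    U = ⨆ p : {p : ℝ × ℝ // openIio p.2 ⊓ openIoi p.1 ≤ U}, openIio p.1.2 ⊓ openIoi p.1.1 := by
  refine le_antisymm (fun x hx ↦ ?_) (iSup_le fun p ↦ p.2)
  obtain ⟨l, r, hxlr, hlr⟩ := mem_nhds_iff_exists_Ioo_subset.mp (U.isOpen.mem_nhds hx)
  have h : openIio r ⊓ openIoi l ≤ U := fun y hy ↦ hlr ⟨hy.2, hy.1⟩
  exact (le_iSup (fun p : {p : ℝ × ℝ // openIio p.2 ⊓ openIoi p.1 ≤ U} ↦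
    openIio p.1.2 ⊓ openIoi p.1.1) ⟨(l, r), h⟩) ⟨hxlr.2, hxlr.1⟩

theorem map_openIoi_le_compl (f : RealFunction M) {r s : ℝ} (h : r ≤ s) :
    f (openIoi s) ≤ (f (openIio r))ᶜ := by
  rw [le_compl_iff_disjoint_left, disjoint_iff, ← map_inf, openIio_inf_openIoi h, map_bot]

theorem map_openIio_ratherBelow (f : RealFunction M) {r s : ℝ} (h : r < s) :
    RatherBelow (f (openIio r)) (f (openIio s)) := by
  refine top_le_iff.mp (le_trans ?_ (sup_le_sup_right (map_openIoi_le_compl f le_rfl) _))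
  rw [← map_sup, openIoi_sup_openIio h, map_top]

theorem map_openIio_completelyBelow (f : RealFunction M) {r s : ℝ} (h : r < s) :
    CompletelyBelow (f (openIio r)) (f (openIio s)) := by
  refine ⟨fun q ↦ f (openIio (r + q * (s - r))), by simp, by simp, fun p q _ hpq _ ↦ ?_⟩
  refine map_openIio_ratherBelow f ?_
  have : (p : ℝ) < q := by exact_mod_cast hpq
  nlinarith

/-- For `r > s`, `f (r, ∞)` is disjoint from `f (-∞, r) = g (-∞, r)`, while `g (s, ∞)` and `g (-∞,
r)` cover; hence `f (r, ∞) ≤ g (s, ∞)`. -/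
theorem map_openIoi_le_of_openIio {f g : RealFunction M}
    (h : ∀ r, f (openIio r) = g (openIio r)) (s : ℝ) : f (openIoi s) ≤ g (openIoi s) := by
  -- The final rewrite restores `openIoi s` on the side of `g`, so that only `f` is expanded.
  rw [openIoi_eq_iSup s, map_iSup, ← openIoi_eq_iSup s]
  refine iSup_le fun r ↦ (map_openIoi_le_compl f le_rfl).trans ?_
  rw [h]
  have hs : g (openIoi s) ⊔ g (openIio r) = ⊤ := by
    rw [← map_sup, openIoi_sup_openIio r.2, map_top]
  calc (g (openIio r))ᶜ = (g (openIio r))ᶜ ⊓ (g (openIoi s) ⊔ g (openIio r)) := by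
        rw [hs, inf_top_eq]
    _ ≤ g (openIoi s) := by
        rw [inf_sup_left, compl_inf_self, sup_bot_eq]
        exact inf_le_right

/-- A continuous real-valued function is determined by its values on the rays `(-∞, r)`. -/
theorem realFunction_ext {f g : RealFunction M} (h : ∀ r, f (openIio r) = g (openIio r)) :
    f = g := by
  refine DFunLike.ext _ _ fun U ↦ ?_
  rw [opens_eq_iSup_openIio_inf_openIoi U, map_iSup, map_iSup]
  refine iSup_congr fun p ↦ ?_
  rw [map_inf, map_inf, h, le_antisymm (map_openIoi_le_of_openIio h p.1.1)
    (map_openIoi_le_of_openIio (fun r ↦ (h r).symm) p.1.1)]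

/-- A scale in a frame: a family indexed by the reals, strictly increasing for the rather below
relation, that takes the values `⊥` and `⊤`. -/
structure IsScale (d : ℝ → M) : Prop where
  ratherBelow : ∀ r s, r < s → RatherBelow (d r) (d s)
  exists_bot : ∃ a, d a = ⊥
  exists_top : ∃ b, d b = ⊤

theorem IsScale.monotone {d : ℝ → M} (hd : IsScale d) : Monotone d := fun r s h ↦ by
  rcases h.eq_or_lt with rfl | h
  · exact le_rfl
  · exact (hd.ratherBelow r s h).le

/-- The value at an open set of the real function defined by a scale. -/
def scaleFun (d : ℝ → M) (U : Opens ℝ) : M :=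
  ⨆ (p : ℝ) (q : ℝ) (_ : Set.Icc p q ⊆ U), d q ⊓ (d p)ᶜ

theorem le_scaleFun (d : ℝ → M) {U : Opens ℝ} {p q : ℝ} (h : Set.Icc p q ⊆ U) :
    d q ⊓ (d p)ᶜ ≤ scaleFun d U :=
  le_iSup₂_of_le p q (le_iSup_of_le h le_rfl)

theorem scaleFun_le {d : ℝ → M} {U : Opens ℝ} {x : M}
    (h : ∀ p q, Set.Icc p q ⊆ U → d q ⊓ (d p)ᶜ ≤ x) : scaleFun d U ≤ x :=
  iSup₂_le fun p q ↦ iSup_le (h p q)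

theorem scaleFun_mono (d : ℝ → M) : Monotone (scaleFun d) := fun _ _ h ↦
  scaleFun_le fun _ _ hpq ↦ le_scaleFun d (hpq.trans h)

/-- Compactness of `[p, q]` in the form needed for `scaleFun` to preserve joins: a bound that holds
locally holds on the whole interval, because the set `A` of good right endpoints reaches past its
own supremum unless it reaches `q`. -/
theorem IsScale.inf_compl_le_of_forall_mem_Icc {d : ℝ → M} (hd : IsScale d) {p q : ℝ} {x : M}
    (h : ∀ t ∈ Set.Icc p q, ∃ ε > 0, d (t + ε) ⊓ (d (t - ε))ᶜ ≤ x) : d q ⊓ (d p)ᶜ ≤ x := by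
  rcases lt_or_ge q p with hqp | hpq
  · calc d q ⊓ (d p)ᶜ ≤ d p ⊓ (d p)ᶜ := inf_le_inf_right _ (hd.monotone hqp.le)
      _ ≤ x := by rw [inf_compl_self]; exact bot_le
  let A : Set ℝ := {t | t ∈ Set.Icc p q ∧ d t ⊓ (d p)ᶜ ≤ x}
  have hpA : p ∈ A := ⟨⟨le_rfl, hpq⟩, by rw [inf_compl_self]; exact bot_le⟩
  have hA : BddAbove A := ⟨q, fun t ht ↦ ht.1.2⟩
  have hsA : sSup A ∈ Set.Icc p q := ⟨le_csSup hA hpA, csSup_le ⟨p, hpA⟩ fun t ht ↦ ht.1.2⟩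
  obtain ⟨ε, hε, hx⟩ := h _ hsA
  obtain ⟨t, ht, hlt⟩ := exists_lt_of_lt_csSup ⟨p, hpA⟩ (sub_lt_self (sSup A) hε)
  -- Since `sSup A - ε < t`, the elements `(d (sSup A - ε))ᶜ` and `d t` cover: the local bound
  -- handles the first, `t ∈ A` the second.
  have key : d (sSup A + ε) ⊓ (d p)ᶜ ≤ x := by
    calc d (sSup A + ε) ⊓ (d p)ᶜ
        = d (sSup A + ε) ⊓ (d p)ᶜ ⊓ ((d (sSup A - ε))ᶜ ⊔ d t) := by
          rw [hd.ratherBelow _ _ hlt, inf_top_eq]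
      _ ≤ x := by
          rw [inf_sup_left]
          exact sup_le ((inf_le_inf_right _ inf_le_left).trans hx)
            (le_trans (le_inf inf_le_right (inf_le_left.trans inf_le_right)) ht.2)
  rcases le_or_gt (sSup A + ε) q with hq | hq
  · have : sSup A + ε ∈ A := ⟨⟨by linarith [hsA.1], hq⟩, key⟩
    linarith [le_csSup hA this]
  · exact (inf_le_inf_right _ (hd.monotone hq.le)).trans key

theorem scaleFun_top {d : ℝ → M} (hd : IsScale d) : scaleFun d ⊤ = ⊤ := by
  obtain ⟨a, ha⟩ := hd.exists_bot
  obtain ⟨b, hb⟩ := hd.exists_top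
  have := le_scaleFun d (U := ⊤) (p := a) (q := b) (Set.subset_univ _)
  rwa [ha, hb, compl_bot, inf_top_eq, top_le_iff] at this

theorem scaleFun_inf (d : ℝ → M) (U V : Opens ℝ) :
    scaleFun d (U ⊓ V) = scaleFun d U ⊓ scaleFun d V := by
  refine le_antisymm (le_inf (scaleFun_mono d inf_le_left) (scaleFun_mono d inf_le_right)) ?_
  rw [← le_himp_iff]
  refine scaleFun_le fun p q hU ↦ ?_
  rw [le_himp_iff, inf_comm, ← le_himp_iff]
  refine scaleFun_le fun p' q' hV ↦ ?_
  rw [le_himp_iff]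
  refine le_trans ?_ (le_scaleFun d (p := max p p') (q := min q q') ?_)
  · rw [inf_inf_inf_comm]
    refine inf_le_inf ?_ ?_
    · rcases min_choice q q' with h | h <;> rw [h]
      · exact inf_le_right
      · exact inf_le_left
    · rcases max_choice p p' with h | h <;> rw [h]
      · exact inf_le_right
      · exact inf_le_left
  · rw [← Set.Icc_inter_Icc]
    exact fun t ht ↦ ⟨hU ht.1, hV ht.2⟩

theorem scaleFun_sSup {d : ℝ → M} (hd : IsScale d) (s : Set (Opens ℝ)) :
    scaleFun d (sSup s) = sSup (scaleFun d '' s) := by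
  refine le_antisymm (scaleFun_le fun p q hpq ↦ ?_)
    (sSup_le (by rintro _ ⟨U, hU, rfl⟩; exact scaleFun_mono d (le_sSup hU)))
  refine hd.inf_compl_le_of_forall_mem_Icc fun t ht ↦ ?_
  obtain ⟨U, hU, htU⟩ := Opens.mem_sSup.mp (hpq ht)
  obtain ⟨ε, hε, h⟩ := Metric.nhds_basis_closedBall.mem_iff.mp (U.isOpen.mem_nhds htU)
  rw [Real.closedBall_eq_Icc] at h
  exact ⟨ε, hε, (le_scaleFun d h).trans (le_sSup ⟨U, hU, rfl⟩)⟩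

/-- The continuous real-valued function defined by a scale. -/
def scaleHom (d : ℝ → M) (hd : IsScale d) : RealFunction M where
  toFun := scaleFun d
  map_inf' := scaleFun_inf d
  map_top' := scaleFun_top hd
  map_sSup' := scaleFun_sSup hd

theorem scaleHom_openIio {d : ℝ → M} (hd : IsScale d) (s : ℝ) :
    scaleHom d hd (openIio s) = ⨆ r : {r : ℝ // r < s}, d r := by
  refine le_antisymm (scaleFun_le fun p q h ↦ ?_) (iSup_le fun r ↦ ?_)
  · rcases lt_or_ge q p with hqp | hpq
    · refine le_trans (inf_le_inf_right _ (hd.monotone hqp.le)) ?_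
      rw [inf_compl_self]
      exact bot_le
    · exact inf_le_left.trans
        (le_iSup (fun r : {r : ℝ // r < s} ↦ d r) ⟨q, h (Set.right_mem_Icc.mpr hpq)⟩)
  · obtain ⟨a, ha⟩ := hd.exists_bot
    have := le_scaleFun d (U := openIio s) (p := a) (q := r) fun t ht ↦ ht.2.trans_lt r.2
    rwa [ha, compl_bot, inf_top_eq] at this

theorem scaleHom_isBounded {d : ℝ → M} (hd : IsScale d) : (scaleHom d hd).IsBounded := by
  obtain ⟨a, ha⟩ := hd.exists_bot
  obtain ⟨b, hb⟩ := hd.exists_top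
  refine ⟨a - 1, b + 1, top_le_iff.mp ?_⟩
  have := le_scaleFun d (U := ⟨Set.Ioo (a - 1) (b + 1), isOpen_Ioo⟩) (p := a) (q := b)
    fun t ht ↦ ⟨by linarith [ht.1], by linarith [ht.2]⟩
  rwa [ha, hb, compl_bot, inf_top_eq] at this

/-- The Urysohn function of a pair `b ≺≺ a`. -/
theorem CompletelyBelow.exists_realFunction {b a : M} (h : CompletelyBelow b a) :
    ∃ f : RealFunction M, f.IsBounded ∧ ∃ r s : ℝ, r < s ∧ b ≤ f (openIio r) ∧
      f (openIio s) ≤ a := by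
  obtain ⟨c, rfl, rfl, hc⟩ := h
  -- Padding by `⊥` and `⊤` outside `[0, 1]` makes the scale attain both values, which gives
  -- boundedness.
  let e : ℚ → M := fun q ↦ if q < 0 then ⊥ else if 1 < q then ⊤ else c q
  have he : ∀ p q, p < q → RatherBelow (e p) (e q) := fun p q hpq ↦ by
    by_cases hp : p < 0
    · simp [e, hp, RatherBelow]
    by_cases hq : 1 < q
    · have : ¬ q < 0 := by linarith
      simp [e, this, hq, RatherBelow]
    have hq0 : ¬ q < 0 := by linarith
    have hp1 : ¬ 1 < p := by linarith
    simp only [e, hp, hq, hq0, hp1, if_false]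
    exact hc p q (not_lt.mp hp) hpq (not_lt.mp hq)
  have hemono : ∀ p q, p ≤ q → e p ≤ e q := fun p q hpq ↦ by
    rcases hpq.eq_or_lt with rfl | h
    · exact le_rfl
    · exact (he p q h).le
  let d : ℝ → M := fun r ↦ ⨆ q : {q : ℚ // (q : ℝ) < r}, e q
  have hde : ∀ (q : ℚ) (r : ℝ), (q : ℝ) < r → e q ≤ d r := fun q r h ↦
    le_iSup (fun q : {q : ℚ // (q : ℝ) < r} ↦ e q) ⟨q, h⟩
  have hed : ∀ (q : ℚ) (r : ℝ), r ≤ q → d r ≤ e q := fun q r h ↦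
    iSup_le fun p ↦ hemono _ _ (by exact_mod_cast (p.2.trans_le h).le)
  have hd : IsScale d := by
    refine ⟨fun r s hrs ↦ ?_, ⟨-1, ?_⟩, ⟨3, ?_⟩⟩
    · obtain ⟨p, hrp, hps⟩ := exists_rat_btwn hrs
      obtain ⟨q, hpq, hqs⟩ := exists_rat_btwn hps
      exact (he p q (by exact_mod_cast hpq)).mono (hed p r hrp.le) (hde q s hqs)
    · exact le_bot_iff.mp ((hed (-1) (-1) (by norm_num)).trans (by norm_num [e]))
    · exact top_le_iff.mp (le_trans (by norm_num [e]) (hde 2 3 (by norm_num)))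
  -- The value on `(-∞, s)` is the join of the `d r` with `r < s`. Hence `c 0 = e 0 ≤ d (1/3)` lies
  -- below the value at `2/3`, and every `d r` with `r < 1` is below `e 1 = c 1`.
  refine ⟨scaleHom d hd, scaleHom_isBounded hd, 2 / 3, 1, by norm_num, ?_, ?_⟩
  · rw [scaleHom_openIio]
    refine le_trans ?_ (le_iSup (fun r : {r : ℝ // r < 2 / 3} ↦ d r) ⟨1 / 3, by norm_num⟩)
    exact le_trans (by norm_num [e]) (hde 0 (1 / 3) (by norm_num))
  · rw [scaleHom_openIio]
    refine iSup_le fun r ↦ (hed 1 r (by exact_mod_cast r.2.le)).trans (by norm_num [e])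

end RealFunctions

/-! ### Preimages and closures of open and closed sublocales -/

section OpenClosed

variable {L M : Type u} [Order.Frame L] [Order.Frame M]

theorem mem_closedSublocale {a x : L} : x ∈ closedSublocale a ↔ a ≤ x := Iff.rfl

theorem mem_openSublocale {a x : L} : x ∈ openSublocale a ↔ a ⇨ x = x := by
  refine ⟨?_, fun h ↦ ⟨x, h.symm⟩⟩
  rintro ⟨b, rfl⟩
  rw [himp_himp, inf_idem]

theorem closedSublocale_injective : Function.Injective (closedSublocale (L := L)) := fun _ _ h ↦
  le_antisymm (mem_closedSublocale.mp (h ▸ mem_closedSublocale.mpr le_rfl))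
    (mem_closedSublocale.mp (h ▸ mem_closedSublocale.mpr le_rfl))

theorem LocalicMap.preimage_closedSublocale (f : LocalicMap L M) (a : M) :
    f.preimage (closedSublocale a) = closedSublocale (f.leftAdjoint a) := by
  ext x
  refine ⟨fun h ↦ ?_, fun h y ↦ ?_⟩
  · have := (f.gc _ _).mpr (mem_closedSublocale.mp (h ⊤))
    rwa [top_himp] at this
  · exact (f.gc _ _).mp (le_trans (mem_closedSublocale.mp h) le_himp)

theorem LocalicMap.preimage_openSublocale (f : LocalicMap L M) (a : M) :
    f.preimage (openSublocale a) = openSublocale (f.leftAdjoint a) := by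
  ext x
  rw [mem_openSublocale]
  refine ⟨fun h ↦ le_antisymm ?_ le_himp, fun h y ↦ ?_⟩
  · have h1 := mem_openSublocale.mp (h (f.leftAdjoint a ⇨ x))
    rw [← f.map_himp, himp_left_comm, himp_self, f.gc.u_top] at h1
    have h2 := (f.gc _ _).mpr h1.le
    rwa [map_top, top_le_iff, himp_eq_top_iff] at h2
  · rw [mem_openSublocale, ← f.map_himp, himp_left_comm, h]

/-- The least element of `𝔬(a)` is `a ⇨ ⊥ = aᶜ`, and the monotone map `β_L` sends it to the least
element of the image. -/
theorem closure_image_unit_openSublocale (a : L) :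
    closure ((StoneCech.unit L).image (openSublocale a)) =
      closedSublocale (StoneCech.below aᶜ) := by
  refine congrArg closedSublocale (IsLeast.isGLB ⟨?_, ?_⟩).sInf_eq
  · exact ⟨aᶜ, ⟨⊥, (himp_bot a).symm⟩, rfl⟩
  · rintro _ ⟨_, ⟨b, rfl⟩, rfl⟩
    refine (StoneCech.unit L).gc.monotone_u ?_
    rw [← himp_bot]
    exact himp_le_himp_left bot_le

/-- A localic map with left adjoint `h` is an `𝔖_𝔬β`-map if and only if `h^β` commutes with
the passage from `b` to the elements completely below its pseudocomplement. -/
theorem isBetaMap_openSelection_iff (f : LocalicMap L M) :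
    IsBetaMap openSelection f ↔ ∀ b : M, StoneCech.below (f.leftAdjoint b)ᶜ =
      StoneCech.mapHom f.leftAdjoint (StoneCech.below bᶜ) := by
  have key (b : M) : closure ((StoneCech.unit L).image (f.preimage (openSublocale b))) =
      (StoneCech.map f).preimage (closure ((StoneCech.unit M).image (openSublocale b))) ↔
      StoneCech.below (f.leftAdjoint b)ᶜ =
        StoneCech.mapHom f.leftAdjoint (StoneCech.below bᶜ) := by
    rw [f.preimage_openSublocale, closure_image_unit_openSublocale,
      closure_image_unit_openSublocale, LocalicMap.preimage_closedSublocale]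
    exact closedSublocale_injective.eq_iff
  refine ⟨fun h b ↦ (key b).mp (h _ ⟨b, rfl⟩), ?_⟩
  rintro h _ ⟨b, rfl⟩
  exact (key b).mpr (h b)

theorem CompletelyBelow.self_of_ratherBelow_self {a : L} (h : RatherBelow a a) :
    CompletelyBelow a a :=
  ⟨fun _ ↦ a, rfl, rfl, fun _ _ _ _ _ ↦ h⟩

theorem CompletelyBelow.ratherBelow {b a : L} (h : CompletelyBelow b a) : RatherBelow b a := by
  obtain ⟨c, rfl, rfl, hc⟩ := h
  exact hc 0 1 le_rfl one_pos le_rfl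

theorem RatherBelow.compl_self {a : L} (h : RatherBelow a a) : RatherBelow aᶜ aᶜ :=
  top_le_iff.mp (h.symm.le.trans (sup_comm aᶜ a ▸ sup_le_sup_right le_compl_compl _))

end OpenClosed

/-! ### Embeddings of sublocales -/

section Embedding

variable {L : Type u} [Order.Frame L] {S : Sublocale L}

theorem le_coe_restrict (S : Sublocale L) (x : L) : x ≤ S.restrict x :=
  S.giRestrict.gc.le_u_l x

theorem restrict_coe (x : S) : S.restrict (x : L) = x := S.giRestrict.l_u_eq x

/-- The element `(x ⇨ s) ⇨ s` belongs to `S` and lies above `x`, so it lies above the reflection of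
`x`. -/
theorem coe_restrict_himp (x : L) (s : S) : (S.restrict x : L) ⇨ s = x ⇨ s := by
  refine le_antisymm (himp_le_himp_right (le_coe_restrict S x)) ?_
  rw [le_himp_comm]
  have h : x ≤ ((⟨(x ⇨ s) ⇨ s, S.himp_mem s.2⟩ : S) : L) := le_himp_himp
  exact S.giRestrict.gc.l_le h

theorem coe_compl_eq_himp (x : S) : ((xᶜ : S) : L) = (x : L) ⇨ ((⊥ : S) : L) := rfl

theorem coe_bot_le (x : S) : ((⊥ : S) : L) ≤ x := (bot_le : ⊥ ≤ x)

theorem closure_eq_closedSublocale_coe_bot (S : Sublocale L) :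
    closure S = closedSublocale ((⊥ : S) : L) := by
  refine congrArg closedSublocale (IsLeast.isGLB ⟨(⊥ : S).2, fun x hx ↦ ?_⟩).sInf_eq
  exact coe_bot_le ⟨x, hx⟩

/-- If `𝔠(a) = 𝔬(b)`, then `b ⊔ a ∈ 𝔬(b)` yields `b ⊔ a = ⊤`, and `bᶜ ∈ 𝔠(a)` yields `b ≤ aᶜ`.
Conversely, `𝔠(a) = 𝔬(aᶜ)` for complemented `a`. -/
theorem isClopenSublocale_closedSublocale_iff {a : L} :
    IsClopenSublocale (closedSublocale a) ↔ RatherBelow a a := by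
  constructor
  · rintro ⟨-, b, h⟩
    have h1 : b ⇨ b ⊔ a = b ⊔ a :=
      mem_openSublocale.mp (h ▸ mem_closedSublocale.mpr le_sup_right)
    have h2 : a ≤ bᶜ := by
      have : bᶜ ∈ closedSublocale a := by
        rw [h]
        exact ⟨⊥, (himp_bot b).symm⟩
      exact mem_closedSublocale.mp this
    rw [himp_eq_top_iff.mpr le_sup_left] at h1
    exact top_le_iff.mp (h1.le.trans (sup_le_sup_right (le_compl_comm.mp h2) _))
  · refine fun h ↦ ⟨⟨a, rfl⟩, aᶜ, ?_⟩
    ext x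
    rw [mem_openSublocale, mem_closedSublocale]
    refine ⟨fun hx ↦ le_antisymm ?_ le_himp, fun hx ↦ ?_⟩
    · calc aᶜ ⇨ x = (aᶜ ⇨ x) ⊓ (aᶜ ⊔ a) := by rw [h, inf_top_eq]
        _ ≤ x := by
          rw [inf_sup_left]
          exact sup_le himp_inf_le (inf_le_right.trans hx)
    · rw [← hx, le_himp_iff, inf_compl_self]
      exact bot_le

theorem isClopenSublocale_closure_iff :
    IsClopenSublocale (closure S) ↔ RatherBelow ((⊥ : S) : L) ((⊥ : S) : L) := by
  rw [closure_eq_closedSublocale_coe_bot, isClopenSublocale_closedSublocale_iff]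

/-- If the closure of `S` is clopen, the reflection onto `S` preserves the rather below relation
of the ambient locale. -/
theorem RatherBelow.coe_restrict (hS : RatherBelow ((⊥ : S) : L) ((⊥ : S) : L)) {x y : L}
    (h : RatherBelow x y) : RatherBelow (S.restrict x : L) (S.restrict y : L) := by
  set z : L := ((⊥ : S) : L)
  -- `xᶜ ≤ x ⇨ z = ν x ⇨ z`, and meeting with `zᶜ` replaces `z` by `⊥`.
  have h1 : xᶜ ⊓ zᶜ ≤ (S.restrict x : L)ᶜ := by
    rw [le_compl_iff_disjoint_right, disjoint_iff_inf_le]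
    have h2 : xᶜ ≤ (S.restrict x : L) ⇨ z := by
      rw [coe_restrict_himp x (⊥ : S), ← himp_bot]
      exact himp_le_himp_left bot_le
    calc xᶜ ⊓ zᶜ ⊓ (S.restrict x : L)
        ≤ ((S.restrict x : L) ⇨ z) ⊓ zᶜ ⊓ (S.restrict x : L) := by gcongr
      _ ≤ z ⊓ zᶜ := le_inf ((inf_le_inf_right _ inf_le_left).trans himp_inf_le)
          (inf_le_left.trans inf_le_right)
      _ = ⊥ := inf_compl_self z
  have h3 : xᶜ ⊓ zᶜ ⊔ (y ⊔ z) = ⊤ := by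
    rw [sup_inf_right, ← sup_assoc, h, top_sup_eq, top_inf_eq, sup_left_comm, hS, sup_top_eq]
  exact top_le_iff.mp (h3.symm.le.trans
    (sup_le_sup h1 (sup_le (le_coe_restrict S y) (coe_bot_le _))))

theorem CompletelyBelow.coe_restrict (hS : RatherBelow ((⊥ : S) : L) ((⊥ : S) : L)) {x y : L}
    (h : CompletelyBelow x y) : CompletelyBelow (S.restrict x : L) (S.restrict y : L) := by
  obtain ⟨c, rfl, rfl, hc⟩ := h
  exact ⟨fun q ↦ S.restrict (c q), rfl, rfl,
    fun p q hp hpq hq ↦ RatherBelow.coe_restrict hS (hc p q hp hpq hq)⟩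

/-- Only one inclusion of ideals has content; the other holds because `ν bᶜ ≤ (ν b)ᶜ`. -/
theorem isBetaMap_embedding_iff : IsBetaMap openSelection (embedding S) ↔
    ∀ (b : L) (x : S), CompletelyBelow x (S.restrict b)ᶜ →
      ∃ y, CompletelyBelow y bᶜ ∧ x ≤ S.restrict y := by
  rw [isBetaMap_openSelection_iff]
  refine ⟨fun h b x hx ↦ ?_, fun h b ↦ le_antisymm (fun x hx ↦ h b x hx) ?_⟩
  · have : x ∈ StoneCech.below (S.restrict b)ᶜ := hx
    exact (h b).le this
  · rintro x ⟨y, hy, hxy⟩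
    refine (CompletelyBelow.map S.restrict hy).mono hxy ?_
    rw [le_compl_iff_disjoint_right, disjoint_iff]
    change S.restrict bᶜ ⊓ S.restrict b = ⊥
    rw [← map_inf, compl_inf_self, map_bot]

theorem restrict_compl_coe_bot (hS : RatherBelow ((⊥ : S) : L) ((⊥ : S) : L)) :
    S.restrict ((⊥ : S) : L)ᶜ = ⊤ := by
  have h : S.restrict (((⊥ : S) : L)ᶜ ⊔ ((⊥ : S) : L)) = ⊤ := by rw [hS, map_top]
  rwa [map_sup, restrict_coe, sup_bot_eq] at h

/-- Taking `b = z` allows `x = ⊤`, as `ν z = ⊥`. The resulting `y ≺≺ zᶜ` has `ν y = ⊤`, so `yᶜ ≤ y ⇨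
z = z`. -/
theorem ratherBelow_coe_bot_of_isBetaMap (h : IsBetaMap openSelection (embedding S)) :
    RatherBelow ((⊥ : S) : L) ((⊥ : S) : L) := by
  obtain ⟨y, hy, hy1⟩ := isBetaMap_embedding_iff.mp h ((⊥ : S) : L) ⊤
    (by rw [restrict_coe, compl_bot]; exact CompletelyBelow.top)
  have h1 : yᶜ ≤ ((⊥ : S) : L) := by
    calc yᶜ ≤ y ⇨ ((⊥ : S) : L) := by rw [← himp_bot]; exact himp_le_himp_left bot_le
      _ = ((⊤ : S) : L) ⇨ ((⊥ : S) : L) := by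
        rw [← coe_restrict_himp, top_le_iff.mp hy1]
      _ = ((⊥ : S) : L) := top_himp
  exact top_le_iff.mp (hy.ratherBelow.symm.le.trans
    (sup_le (h1.trans le_sup_right) le_sup_left))

theorem RatherBelow.compl_compl_le {M : Type u} [Order.Frame M] {b a : M} (h : RatherBelow b a) :
    bᶜᶜ ≤ a := by
  calc bᶜᶜ = bᶜᶜ ⊓ (bᶜ ⊔ a) := by rw [h, inf_top_eq]
    _ ≤ a := by
      rw [inf_sup_left, compl_inf_self, bot_sup_eq]
      exact inf_le_right

theorem preservesCompletelyBelow_of_isBetaMap (h : IsBetaMap openSelection (embedding S)) :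
    (embedding S).PreservesCompletelyBelow := by
  have hS := ratherBelow_coe_bot_of_isBetaMap h
  intro a b hab
  obtain ⟨c, hac, hcb⟩ := hab.interpolate
  -- The criterion only reaches pseudocomplements, so it is applied to `cᶜ`; the passage to `cᶜᶜ`
  -- costs nothing because `c ≺ b` gives `cᶜᶜ ≤ b`.
  obtain ⟨y, hy, hay⟩ := isBetaMap_embedding_iff.mp h ((cᶜ : S) : L) a
    (by rw [restrict_coe]; exact hac.mono le_rfl le_compl_compl)
  refine (hy.coe_restrict hS).mono hay (S.giRestrict.gc.l_le ?_)
  calc ((cᶜ : S) : L)ᶜ ≤ ((cᶜᶜ : S) : L) := by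
        rw [coe_compl_eq_himp, ← himp_bot]
        exact himp_le_himp_left bot_le
    _ ≤ (b : L) := hcb.ratherBelow.compl_compl_le

theorem ratherBelow_coe_bot_of_preservesCompletelyBelow
    (h : (embedding S).PreservesCompletelyBelow) : RatherBelow ((⊥ : S) : L) ((⊥ : S) : L) :=
  (h ⊥ ⊥ (CompletelyBelow.bot _)).ratherBelow

theorem isBetaMap_of_preservesCompletelyBelow (h : (embedding S).PreservesCompletelyBelow) :
    IsBetaMap openSelection (embedding S) := by
  have hS := ratherBelow_coe_bot_of_preservesCompletelyBelow h
  -- In `L`, `(ν b)ᶜ` is `b ⇨ z`, which may exceed `bᶜ`; its meet with `zᶜ` lies below `bᶜ`.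
  refine isBetaMap_embedding_iff.mpr fun b x hx ↦ ⟨(x : L) ⊓ ((⊥ : S) : L)ᶜ, ?_, ?_⟩
  · have h1 : CompletelyBelow (x : L) (((S.restrict b)ᶜ : S) : L) := h _ _ hx
    refine (h1.inf (CompletelyBelow.self_of_ratherBelow_self hS.compl_self)).mono le_rfl ?_
    rw [coe_compl_eq_himp, coe_restrict_himp, le_compl_iff_disjoint_right, disjoint_iff_inf_le]
    calc (b ⇨ ((⊥ : S) : L)) ⊓ ((⊥ : S) : L)ᶜ ⊓ b ≤ ((⊥ : S) : L) ⊓ ((⊥ : S) : L)ᶜ :=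
          le_inf ((inf_le_inf_right _ inf_le_left).trans himp_inf_le)
            (inf_le_left.trans inf_le_right)
      _ = ⊥ := inf_compl_self _
  · rw [map_inf, restrict_coe, restrict_compl_coe_bot hS, inf_top_eq]

/-! ### Relation to `C*`-embedding -/

theorem preservesCompletelyBelow_of_isCStarEmbedded (hC : IsCStarEmbedded S)
    (hS : RatherBelow ((⊥ : S) : L) ((⊥ : S) : L)) : (embedding S).PreservesCompletelyBelow := by
  intro a b hab
  obtain ⟨f, hf, r, s, hrs, har, hsb⟩ := hab.exists_realFunction
  obtain ⟨g, rfl⟩ := hC f hf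
  exact ((map_openIio_completelyBelow g hrs).coe_restrict hS).mono har hsb

theorem isCStarEmbedded_of_preservesCompletelyBelow
    (h : (embedding S).PreservesCompletelyBelow) : IsCStarEmbedded S := by
  have hS := ratherBelow_coe_bot_of_preservesCompletelyBelow h
  rintro f ⟨a, b, hab⟩
  have ha : f (openIio a) = ⊥ := by
    rw [← inf_top_eq (f (openIio a)), ← hab, ← map_inf, ← le_bot_iff, ← map_bot f]
    exact OrderHomClass.mono f fun x hx ↦ absurd hx.1 (not_lt.mpr hx.2.1.le)
  have hb : ∀ r, b ≤ r → f (openIio r) = ⊤ := fun r hr ↦ by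
    rw [← top_le_iff, ← hab]
    exact OrderHomClass.mono f fun x hx ↦ lt_of_lt_of_le hx.2 hr
  classical
  -- The factor `zᶜ` lets the scale attain `⊥` in `L`, where the bottom of `S` is only `z`; the jump
  -- past `b` supplies `⊤`. Neither changes the image under `ν`.
  let d : ℝ → L := fun r ↦ if b < r then ⊤ else (f (openIio r) : L) ⊓ ((⊥ : S) : L)ᶜ
  have hdf : ∀ r, S.restrict (d r) = f (openIio r) := fun r ↦ by
    by_cases hr : b < r
    · simp only [d, hr, if_true]
      rw [map_top, hb r hr.le]
    · simp only [d, hr, if_false]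
      rw [map_inf, restrict_coe, restrict_compl_coe_bot hS, inf_top_eq]
  have hd : IsScale d := by
    -- If `S` is trivial, `a ≤ b` may fail; `min a b` stays out of the range where `d` is `⊤`.
    refine ⟨fun r s hrs ↦ ?_, ⟨min a b, ?_⟩, ⟨b + 1, by simp [d]⟩⟩
    · by_cases hs : b < s
      · simp [d, hs, RatherBelow]
      · have hr : ¬ b < r := fun hr ↦ hs (hr.trans hrs)
        simp only [d, hs, hr, if_false]
        have h1 : RatherBelow (f (openIio r) : L) (f (openIio s) : L) :=
          (h _ _ (map_openIio_completelyBelow f hrs)).ratherBelow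
        exact h1.inf hS.compl_self
    · have h1 : f (openIio (min a b)) = ⊥ := by
        rw [← le_bot_iff, ← ha]
        exact OrderHomClass.mono f fun x hx ↦ lt_of_lt_of_le hx (min_le_left a b)
      simp only [d, (min_le_right a b).not_gt, if_false, h1]
      exact inf_compl_self _
  refine ⟨scaleHom d hd, realFunction_ext fun s ↦ ?_⟩
  change S.restrict (scaleHom d hd (openIio s)) = f (openIio s)
  rw [scaleHom_openIio, map_iSup, openIio_eq_iSup s, map_iSup]
  exact iSup_congr fun r ↦ hdf r

end Embedding

end Loc

/-- For a sublocale `S` of a locale `L` with localic embedding `j : S ↪ L`, the map `j` is an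
`𝔖_𝔬β`-map if and only if `S` is `C*`-embedded in `L` and the closure of `S` is clopen; and `j` is an
`𝔖_𝔬β`-map if and only if it preserves the completely below relation. -/
theorem mainTheorem10 {L : Type u} [Order.Frame L] (S : Sublocale L) :
    (Loc.IsBetaMap Loc.openSelection (Loc.embedding S) ↔
      Loc.IsCStarEmbedded S ∧ Loc.IsClopenSublocale (Loc.closure S)) ∧
    (Loc.IsBetaMap Loc.openSelection (Loc.embedding S) ↔
      (Loc.embedding S).PreservesCompletelyBelow) := by
  have h : Loc.IsBetaMap Loc.openSelection (Loc.embedding S) ↔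
      (Loc.embedding S).PreservesCompletelyBelow :=
    ⟨Loc.preservesCompletelyBelow_of_isBetaMap, Loc.isBetaMap_of_preservesCompletelyBelow⟩
  refine ⟨h.trans ⟨fun hp ↦ ⟨Loc.isCStarEmbedded_of_preservesCompletelyBelow hp, ?_⟩, ?_⟩, h⟩
  · exact Loc.isClopenSublocale_closure_iff.mpr
      (Loc.ratherBelow_coe_bot_of_preservesCompletelyBelow hp)
  · exact fun ⟨hC, hS⟩ ↦ Loc.preservesCompletelyBelow_of_isCStarEmbedded hC
      (Loc.isClopenSublocale_closure_iff.mp hS)
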